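/- Let $p$ be a prime, let $k$ be an algebraically closed field of characteristic $p$, let $G$ be a finite group and let $P\le G$ be a $p$-subgroup. For a subgroup $H$ of a finite group $L$, the Scott module $S(L,H)$ is the indecomposable direct summand, unique up to isomorphism, of the permutation module $\mathrm{Ind}_H^L(k)$ (where $k$ is the trivial $kH$-module) whose socle contains the trivial $kL$-module. For a $kL$-module $M$ and subgroups $R\le Q$ of $L$, let $M^Q$ be the set of $Q$-fixed points of $M$, let $M_R^Q=\{\sum_{x\in[Q/R]}xm \mid m\in M^R\}$, and let $M(Q)=M^Q/\sum_{R<Q}M_R^Q$ be the Brauer construction, a $kN_L(Q)$-module. A finite-dimensional $kL$-module $M$ is called Brauer indecomposable if for every $p$-subgroup $Q\le L$ the module $\mathrm{Res}^{N_L(Q)}_{QC_L(Q)}M(Q)$ is indecomposable or zero. Put $\ker(M)=\{g\in L\mid gm=m \text{ for all } m\in M\}$. Suppose that $P\le\ker(S(G,P))$ and that $N_G(P)$ is a $p$-group. If $S(N_G(P),P)$ is Brauer indecomposable, then $S(G,P)$ is Brauer indecomposable. -/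

import Mathlib

namespace Representation

section Basic

variable {k G V W : Type*} [CommRing k] [Group G] [AddCommGroup V] [Module k V]
  [AddCommGroup W] [Module k W]

/-- A representation is indecomposable if it is nonzero and is not the internal direct sum of two
nonzero subrepresentations. -/
def IsIndecomposable (ρ : Representation k G V) : Prop :=
  Nontrivial V ∧ ∀ A B : Subrepresentation ρ, IsCompl A B → A = ⊥ ∨ B = ⊥

/-- `σ ∣ ρ`: the representation `σ` is isomorphic to a direct summand of `ρ`, that is, there are
equivariant maps `i : σ → ρ` and `r : ρ → σ` with `r ∘ i = id`. -/
def IsSummand (σ : Representation k G W) (ρ : Representation k G V) : Prop :=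
  ∃ (i : IntertwiningMap σ ρ) (r : IntertwiningMap ρ σ), r.comp i = IntertwiningMap.id σ

/-- The permutation module `Ind_H^G(k)` induced from the trivial `kH`-module. -/
noncomputable abbrev indTrivial (k : Type*) [CommRing k] (H : Subgroup G) :
    Representation k G (IndV H.subtype (trivial k H k)) :=
  ind H.subtype (trivial k H k)

/-- `ρ` is (a model of) the Scott module `S(G, H)`: an indecomposable `kG`-module that is isomorphic
to a direct summand of `Ind_H^G(k)` and whose socle has the trivial module as a summand. The trivial
module is simple, so the last condition says that it embeds in `ρ`. -/
def IsScottModule (ρ : Representation k G V) (H : Subgroup G) : Prop :=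
  ρ.IsIndecomposable ∧ ρ.IsSummand (indTrivial k H) ∧
    ∃ f : IntertwiningMap (trivial k G k) ρ, Function.Injective f

/-- The fixed points `M^Q` of a subgroup `Q`. -/
noncomputable def fixedBy (ρ : Representation k G V) (Q : Subgroup G) : Submodule k V :=
  invariants (ρ.comp Q.subtype)

lemma mem_fixedBy {ρ : Representation k G V} {Q : Subgroup G} {v : V} :
    v ∈ ρ.fixedBy Q ↔ ∀ g ∈ Q, ρ g v = v := by
  simp [fixedBy]

/-- For `R ≤ Q`, the map `m ↦ ∑_{x ∈ [Q/R]} x m`. On `M^R` it does not depend on the coset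
representatives, see `out_apply_of_mem_fixedBy`. -/
noncomputable def relTrace (ρ : Representation k G V) (R Q : Subgroup G) : V →ₗ[k] V :=
  ∑ᶠ x : Q ⧸ R.subgroupOf Q, ρ ((x.out : Q) : G)

lemma out_apply_of_mem_fixedBy (ρ : Representation k G V) {R Q : Subgroup G} {v : V}
    (hv : v ∈ ρ.fixedBy R) (q : Q) :
    ρ (((QuotientGroup.mk q : Q ⧸ R.subgroupOf Q).out : Q) : G) v = ρ (q : G) v := by
  obtain ⟨h, hh⟩ := QuotientGroup.mk_out_eq_mul (R.subgroupOf Q) q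
  have h2 : ((h : Q) : G) ∈ R := Subgroup.mem_subgroupOf.1 h.2
  rw [hh, Subgroup.coe_mul, map_mul, Module.End.mul_apply, mem_fixedBy.1 hv _ h2]

lemma relTrace_apply [Finite G] (ρ : Representation k G V) (R Q : Subgroup G) (v : V) :
    ρ.relTrace R Q v = ∑ᶠ x : Q ⧸ R.subgroupOf Q, ρ ((x.out : Q) : G) v := by
  let _ := Fintype.ofFinite (Q ⧸ R.subgroupOf Q)
  simp [relTrace, finsum_eq_sum_of_fintype, LinearMap.sum_apply]

/-- The image `M_R^Q` of `M^R` under the relative trace from `R` to `Q`. -/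
noncomputable def traceImage (ρ : Representation k G V) (R Q : Subgroup G) : Submodule k V :=
  (ρ.fixedBy R).map (ρ.relTrace R Q)

/-- The sum `∑_{R < Q} M_R^Q` over the proper subgroups of `Q`. -/
noncomputable def properTraces (ρ : Representation k G V) (Q : Subgroup G) : Submodule k V :=
  ⨆ (R : Subgroup G) (_ : R < Q), ρ.traceImage R Q

lemma apply_mem_fixedBy (ρ : Representation k G V) {Q : Subgroup G} {g : G}
    (hg : g ∈ Subgroup.normalizer (Q : Set G)) {v : V} (hv : v ∈ ρ.fixedBy Q) :
    ρ g v ∈ ρ.fixedBy Q := by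
  rw [mem_fixedBy] at hv ⊢
  intro q hq
  have h1 : g⁻¹ * q * g ∈ Q := by
    have h3 := (Subgroup.mem_normalizer_iff.1 (inv_mem hg) q).1 hq
    simpa using h3
  have h2 : q * g = g * (g⁻¹ * q * g) := by group
  rw [← Module.End.mul_apply, ← map_mul, h2, map_mul, Module.End.mul_apply, hv _ h1]

lemma apply_relTrace [Finite G] (ρ : Representation k G V) {R Q : Subgroup G} {g : G}
    (hg : g ∈ Subgroup.normalizer (Q : Set G)) {v : V} (hv : v ∈ ρ.fixedBy R) :
    ρ g (ρ.relTrace R Q v) = ρ.relTrace (R.map (MulAut.conj g).toMonoidHom) Q (ρ g v) ∧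
      ρ g v ∈ ρ.fixedBy (R.map (MulAut.conj g).toMonoidHom) := by
  have hfix : ρ g v ∈ ρ.fixedBy (R.map (MulAut.conj g).toMonoidHom) := by
    rw [mem_fixedBy]
    rintro _ ⟨r, hr, rfl⟩
    have h2 : (MulAut.conj g).toMonoidHom r * g = g * r := by simp
    rw [← Module.End.mul_apply, ← map_mul, h2, map_mul, Module.End.mul_apply,
      mem_fixedBy.1 hv r hr]
  refine ⟨?_, hfix⟩
  have hc (q : Q) : g * q * g⁻¹ ∈ Q := (Subgroup.mem_normalizer_iff.1 hg q).1 q.2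
  let _ := Fintype.ofFinite (Q ⧸ R.subgroupOf Q)
  rw [relTrace_apply, relTrace_apply, finsum_eq_sum_of_fintype, map_sum,
    ← finsum_eq_sum_of_fintype]
  refine finsum_eq_of_bijective
    (fun x => QuotientGroup.mk ⟨g * (x.out : Q) * g⁻¹, hc x.out⟩) ⟨?_, ?_⟩ ?_
  · intro x y hxy
    rw [QuotientGroup.eq, Subgroup.mem_subgroupOf] at hxy
    obtain ⟨r, hr, hr2⟩ := hxy
    rw [← QuotientGroup.out_eq' x, ← QuotientGroup.out_eq' y, QuotientGroup.eq,
      Subgroup.mem_subgroupOf]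
    have h3 : r = (((x.out : Q)⁻¹ * (y.out : Q) : Q) : G) := by
      have h4 : g * r * g⁻¹ = g * (((x.out : Q) : G)⁻¹ * ((y.out : Q) : G)) * g⁻¹ := by
        simpa [mul_assoc] using hr2
      simpa using h4
    rw [← h3]
    exact hr
  · intro y
    have h1 : g⁻¹ * (y.out : Q) * g ∈ Q := by
      have h3 := (Subgroup.mem_normalizer_iff.1 (inv_mem hg) ((y.out : Q) : G)).1 (y.out : Q).2
      simpa using h3
    refine ⟨QuotientGroup.mk ⟨_, h1⟩, ?_⟩
    obtain ⟨h, hh⟩ := QuotientGroup.mk_out_eq_mul (R.subgroupOf Q) ⟨_, h1⟩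
    have h2 : ((h : Q) : G) ∈ R := Subgroup.mem_subgroupOf.1 h.2
    conv_rhs => rw [← QuotientGroup.out_eq' y]
    rw [QuotientGroup.eq, Subgroup.mem_subgroupOf]
    refine ⟨((h : Q) : G)⁻¹, inv_mem h2, ?_⟩
    rw [hh]
    simp [mul_assoc]
  · intro x
    rw [out_apply_of_mem_fixedBy ρ hfix, ← Module.End.mul_apply, ← Module.End.mul_apply,
      ← map_mul, ← map_mul]
    simp

lemma apply_mem_properTraces [Finite G] (ρ : Representation k G V) {Q : Subgroup G} {g : G}
    (hg : g ∈ Subgroup.normalizer (Q : Set G)) {v : V} (hv : v ∈ ρ.properTraces Q) :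
    ρ g v ∈ ρ.properTraces Q := by
  have h1 : ρ.properTraces Q ≤ (ρ.properTraces Q).comap (ρ g) := by
    refine iSup₂_le fun R hR => ?_
    rintro _ ⟨m, hm, rfl⟩
    obtain ⟨h2, h3⟩ := apply_relTrace ρ (Q := Q) hg hm
    rw [Submodule.mem_comap, h2]
    have hlt : R.map (MulAut.conj g).toMonoidHom < Q := by
      conv_rhs => rw [← Subgroup.mem_normalizer_iff_map_conj_eq.1 hg]
      exact (Subgroup.map_lt_map_iff_of_injective (MulAut.conj g).injective).2 hR
    exact Submodule.mem_iSup_of_mem _ (Submodule.mem_iSup_of_mem hlt ⟨_, h3, rfl⟩)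
  exact h1 hv

/-- The relative traces are fixed points, so that `M(Q)` below is a quotient of `M^Q` by a
submodule of `M^Q`. -/
lemma properTraces_le_fixedBy [Finite G] (ρ : Representation k G V) (Q : Subgroup G) :
    ρ.properTraces Q ≤ ρ.fixedBy Q := by
  refine iSup₂_le fun R hR => ?_
  rintro _ ⟨m, hm, rfl⟩
  rw [mem_fixedBy]
  intro q hq
  let _ := Fintype.ofFinite (Q ⧸ R.subgroupOf Q)
  rw [relTrace_apply, finsum_eq_sum_of_fintype, map_sum, ← finsum_eq_sum_of_fintype, ← finsum_eq_sum_of_fintype]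
  refine finsum_eq_of_bijective (f := fun x : Q ⧸ R.subgroupOf Q => ρ q (ρ ((x.out : Q) : G) m))
    (g := fun x : Q ⧸ R.subgroupOf Q => ρ ((x.out : Q) : G) m)
    (fun x => (⟨q, hq⟩ : Q) • x) (MulAction.bijective (⟨q, hq⟩ : Q)) fun x => ?_
  have h1 : (⟨q, hq⟩ : Q) • x = QuotientGroup.mk (⟨q, hq⟩ * (x.out : Q)) := by
    conv_lhs => rw [← QuotientGroup.out_eq' x]
    rfl
  rw [h1, out_apply_of_mem_fixedBy ρ hm, ← Module.End.mul_apply, ← map_mul]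
  rfl

/-- The underlying module of the Brauer construction: `M(Q) = M^Q / ∑_{R < Q} M_R^Q`. -/
abbrev BrauerQuotient (ρ : Representation k G V) (Q : Subgroup G) :=
  ρ.fixedBy Q ⧸ (ρ.properTraces Q).comap (ρ.fixedBy Q).subtype

/-- The Brauer construction `M(Q)` as a representation of `N_G(Q)`. -/
noncomputable def brauer [Finite G] (ρ : Representation k G V) (Q : Subgroup G) :
    Representation k (Subgroup.normalizer (Q : Set G)) (ρ.BrauerQuotient Q) :=
  quotient
    (subrepresentation (ρ.comp (Subgroup.normalizer (Q : Set G)).subtype) (ρ.fixedBy Q)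
      fun g _ hv => ρ.apply_mem_fixedBy g.2 hv)
    ((ρ.properTraces Q).comap (ρ.fixedBy Q).subtype)
    fun g _ hv => ρ.apply_mem_properTraces g.2 hv

lemma sup_centralizer_le_normalizer (Q : Subgroup G) :
    Q ⊔ Subgroup.centralizer (Q : Set G) ≤ Subgroup.normalizer (Q : Set G) := by
  refine sup_le Subgroup.le_normalizer fun g hg => ?_
  rw [Subgroup.mem_normalizer_iff]
  intro h
  have key (a b : G) (ha : a ∈ Subgroup.centralizer (Q : Set G)) (hb : b ∈ Q) :
      a * b * a⁻¹ = b := by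
    rw [← Subgroup.mem_centralizer_iff.1 ha b hb, mul_inv_cancel_right]
  constructor
  · intro hh
    rwa [key g h hg hh]
  · intro hh
    have h1 := key g⁻¹ _ (inv_mem hg) hh
    have h2 : h = g * h * g⁻¹ := by simpa [mul_assoc] using h1
    rwa [h2]

/-- `M` is Brauer indecomposable (at the prime `p`): for every `p`-subgroup `Q` of `G`, the
restriction of `M(Q)` from `N_G(Q)` to `Q C_G(Q)` is zero or indecomposable. -/
def IsBrauerIndecomposable [Finite G] (p : ℕ) (ρ : Representation k G V) : Prop :=
  ∀ Q : Subgroup G, IsPGroup p Q →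
    Subsingleton (ρ.BrauerQuotient Q) ∨
      IsIndecomposable
        ((ρ.brauer Q).comp (Subgroup.inclusion (sup_centralizer_le_normalizer Q)))

end Basic

section Existence

universe u v w

lemma IsSummand.trans {k G U V W : Type*} [CommRing k] [Group G] [AddCommGroup U] [Module k U]
    [AddCommGroup V] [Module k V] [AddCommGroup W] [Module k W] {ρ : Representation k G U}
    {σ : Representation k G V} {τ : Representation k G W} (h₁ : ρ.IsSummand σ)
    (h₂ : σ.IsSummand τ) : ρ.IsSummand τ := by
  obtain ⟨i, r, h⟩ := h₁
  obtain ⟨i', r', h'⟩ := h₂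
  refine ⟨i'.comp i, r.comp r', ?_⟩
  ext u
  have e1 (x : V) : r' (i' x) = x := congrArg (fun f => f x) h'
  have e2 (x : U) : r (i x) = x := congrArg (fun f => f x) h
  change r (r' (i' (i u))) = u
  rw [e1, e2]

lemma isSummand_of_isCompl {k G V : Type*} [CommRing k] [Group G] [AddCommGroup V] [Module k V]
    {ρ : Representation k G V} {A B : Subrepresentation ρ}
    (hAB : IsCompl A.toSubmodule B.toSubmodule) : A.toRepresentation.IsSummand ρ := by
  refine ⟨⟨A.toSubmodule.subtype, fun g => rfl⟩,
    ⟨A.toSubmodule.projectionOnto B.toSubmodule hAB, fun g => ?_⟩, ?_⟩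
  · ext v
    obtain ⟨a, b, ha, hb, rfl⟩ := (Submodule.codisjoint_iff_exists_add_eq.1 hAB.codisjoint) v
    have h1 := A.apply_mem_toSubmodule g ha
    have h2 := B.apply_mem_toSubmodule g hb
    have p1 := Submodule.projectionOnto_apply_left hAB ⟨_, h1⟩
    have p2 := Submodule.projectionOnto_apply_left hAB ⟨_, ha⟩
    have q1 := Submodule.projectionOnto_apply_right hAB ⟨_, h2⟩
    have q2 := Submodule.projectionOnto_apply_right hAB ⟨_, hb⟩
    simp only at p1 p2 q1 q2
    simp [map_add, p1, p2, q1, q2, Subrepresentation.toRepresentation]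
  · ext v
    have p2 := Submodule.projectionOnto_apply_left hAB v
    exact congrArg Subtype.val p2

lemma isCompl_toSubmodule {k G V : Type*} [CommRing k] [Group G] [AddCommGroup V] [Module k V]
    {ρ : Representation k G V} {A B : Subrepresentation ρ} (h : IsCompl A B) :
    IsCompl A.toSubmodule B.toSubmodule := by
  constructor
  · rw [disjoint_iff]
    exact congrArg Subrepresentation.toSubmodule h.inf_eq_bot
  · rw [codisjoint_iff]
    exact congrArg Subrepresentation.toSubmodule h.sup_eq_top

lemma exists_indecomposable_summand {k : Type u} {G : Type v} [Field k] [Group G] (n : ℕ) :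
    ∀ {V : Type w} [AddCommGroup V] [Module k V] [Module.Finite k V] (ρ : Representation k G V)
      (v : V), (∀ g, ρ g v = v) → v ≠ 0 → Module.finrank k V ≤ n →
    ∃ (W : Type w) (_ : AddCommGroup W) (_ : Module k W) (σ : Representation k G W),
      σ.IsIndecomposable ∧ σ.IsSummand ρ ∧ ∃ x : W, x ≠ 0 ∧ ∀ g, σ g x = x := by
  induction n with
  | zero =>
    intro V _ _ _ ρ v hv hv0 hn
    have h1 : Subsingleton V := Module.finrank_zero_iff.1 (Nat.le_zero.1 hn)
    exact absurd (Subsingleton.elim v 0) hv0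
  | succ n ih =>
    intro V _ _ _ ρ v hv hv0 hn
    by_cases hind : ρ.IsIndecomposable
    · exact ⟨V, _, _, ρ, hind, ⟨.id ρ, .id ρ, rfl⟩, v, hv0, hv⟩
    have hnt : Nontrivial V := ⟨v, 0, hv0⟩
    have hex : ∃ A B : Subrepresentation ρ, IsCompl A B ∧ A ≠ ⊥ ∧ B ≠ ⊥ := by
      by_contra! hcon
      refine hind ⟨hnt, fun A B hAB => ?_⟩
      by_cases hA : A = ⊥
      · exact Or.inl hA
      · exact Or.inr (hcon A B hAB hA)
    obtain ⟨A, B, hAB, hA, hB⟩ := hex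
    have key : ∀ A B : Subrepresentation ρ, IsCompl A B → B ≠ ⊥ →
        (∃ a ∈ A, a ≠ 0 ∧ ∀ g, ρ g a = a) →
        ∃ (W : Type w) (_ : AddCommGroup W) (_ : Module k W) (σ : Representation k G W),
          σ.IsIndecomposable ∧ σ.IsSummand ρ ∧ ∃ x : W, x ≠ 0 ∧ ∀ g, σ g x = x := by
      rintro A B hAB hB ⟨a, haA, ha0, ha⟩
      have hlt : Module.finrank k A.toSubmodule < Module.finrank k V := by
        apply Submodule.finrank_lt
        intro htop
        have h1 : A = ⊤ := Subrepresentation.toSubmodule_injective htop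
        rw [h1] at hAB
        exact hB (by simpa using hAB.inf_eq_bot)
      obtain ⟨W, i1, i2, σ, h1, h2, h3⟩ := ih A.toRepresentation ⟨a, haA⟩
        (fun g => Subtype.ext (ha g)) (fun h => ha0 (congrArg Subtype.val h)) (by omega)
      exact ⟨W, i1, i2, σ, h1, h2.trans (isSummand_of_isCompl (isCompl_toSubmodule hAB)), h3⟩
    have hc := isCompl_toSubmodule hAB
    obtain ⟨a, b, ha, hb, hab⟩ := (Submodule.codisjoint_iff_exists_add_eq.1 hc.codisjoint) v
    have hfix (g : G) : ρ g a = a ∧ ρ g b = b := by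
      have h1 : ρ g a - a = b - ρ g b := by
        have h0 := hv g
        rw [← hab, map_add] at h0
        rw [sub_eq_sub_iff_add_eq_add, h0, add_comm]
      have h2 : ρ g a - a ∈ A.toSubmodule :=
        Submodule.sub_mem _ (A.apply_mem_toSubmodule g ha) ha
      have h3 : ρ g a - a ∈ B.toSubmodule := by
        rw [h1]
        exact Submodule.sub_mem _ hb (B.apply_mem_toSubmodule g hb)
      have h4 := Submodule.disjoint_def.1 hc.disjoint _ h2 h3
      refine ⟨sub_eq_zero.1 h4, ?_⟩
      rw [h1] at h4
      exact (sub_eq_zero.1 h4).symm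
    by_cases ha0 : a = 0
    · refine key B A hAB.symm hA ⟨b, hb, ?_, fun g => (hfix g).2⟩
      rintro rfl
      exact hv0 (by rw [← hab, ha0, add_zero])
    · exact key A B hAB hB ⟨a, ha, ha0, fun g => (hfix g).1⟩

/-- Scott modules exist for every subgroup of a finite group. -/
theorem exists_isScottModule (k : Type u) {G : Type v} [Field k] [Group G] [Finite G]
    (H : Subgroup G) :
    ∃ (W : Type (max u v)) (_ : AddCommGroup W) (_ : Module k W) (σ : Representation k G W),
      σ.IsScottModule H := by
  classical
  let A : Rep k H := Rep.of (trivial k H k)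
  let f : coindV H.subtype (trivial k H k) := ⟨fun _ => 1, fun _ _ => rfl⟩
  let w : IndV H.subtype (trivial k H k) := Rep.coindToInd A f
  have hw0 : w ≠ 0 := by
    intro h
    have h1 := LinearMap.congr_fun (Rep.coindToInd_indToCoind A) f
    have h2 : Rep.indToCoind A w = f := h1
    rw [h, map_zero] at h2
    have h3 := congrFun (congrArg Subtype.val h2) 1
    exact zero_ne_one (α := k) h3
  have hw (g : G) : indTrivial k H g w = w := by
    have h1 := (Rep.indCoindIso A).inv.hom.isIntertwining' g
    have h2 := LinearMap.congr_fun h1 f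
    exact h2.symm
  have hfin : Module.Finite k (IndV H.subtype (trivial k H k)) := by
    have : Module.Finite k (MonoidAlgebra k G) :=
      Module.Finite.equiv (MonoidAlgebra.coeffLinearEquiv k).symm
    infer_instance
  obtain ⟨W, i1, i2, σ, h1, h2, x, hx0, hx⟩ :=
    exists_indecomposable_summand _ (indTrivial k H) w hw hw0 le_rfl
  refine ⟨W, i1, i2, σ, h1, h2, ⟨LinearMap.toSpanSingleton k W x, fun g => ?_⟩, ?_⟩
  · ext
    simp [hx g]
  · exact smul_left_injective k hx0

end Existence

end Representation

/-! Write `K` for the kernel of `S = S(G, P)` and `N` for `N_G(P)`. Being a summand of the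
permutation module on `G ⧸ P`, `S` has `S(Q) = 0` whenever the `p`-subgroup `Q` has no fixed point
there, that is, whenever `Q` is not conjugate into `P` (`IsSummand.subsingleton_brauerQuotient`). As
`P ≤ K` and `K` is normal, this disposes of every `Q` not contained in `K`.

If `Q ≤ K`, then `S(Q)` is `S` itself, so `Q` is conjugate into `P`, and it remains to see that `S`
stays indecomposable over `Q C_G(Q)`. This follows from `G = C_G(Q) K`, because then `C_G(Q)` has
the same image in `GL(S)` as `G`.

Two facts give that factorization. The same vanishing argument shows that `P` is a Sylow
`p`-subgroup of `K`, so `G = N K` by Frattini (`IsSummand.normalizer_sup_ker_eq_top`). Moreover `N`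
is a `p`-group, so the transitive permutation module `k[N ⧸ P]` is indecomposable and equals `S(N,
P)`. For `Q ≤ P` its Brauer construction at `Q` is again `k[N ⧸ P]`, and indecomposability over `Q
C_N(Q)` forces that group to be transitive on `N ⧸ P`, whence `N = C_N(Q) P`
(`IsScottModule.centralizer_sup_eq_top`). -/

namespace Representation

/-! ### Induced trivial modules as modules of functions on cosets -/

section FunRep

variable {k G : Type*} [CommRing k] [Group G]

/-- The permutation module of functions on a `G`-set. -/
def funRep (k : Type*) [CommRing k] (G : Type*) [Group G] (X : Type*) [MulAction G X] :
    Representation k G (X → k) where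
  toFun g := LinearMap.funLeft k k (g⁻¹ • ·)
  map_one' := by ext; simp
  map_mul' _ _ := by ext; simp [mul_smul]

@[simp]
lemma funRep_apply (X : Type*) [MulAction G X] (g : G) (f : X → k) (x : X) :
    funRep k G X g f x = f (g⁻¹ • x) := rfl

lemma funRep_single (X : Type*) [MulAction G X] [DecidableEq X] (g : G) (x : X) (c : k) :
    funRep k G X g (Pi.single x c) = Pi.single (g • x) c := by
  ext y
  simp [Pi.single_apply, inv_smul_eq_iff]

/-- The coinduced trivial module is the module of functions on `G ⧸ H`. -/
lemma coind_trivial_isSummand_funRep (H : Subgroup G) :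
    (coind H.subtype (trivial k H k)).IsSummand (funRep k G (G ⧸ H)) := by
  -- Coinduced functions are constant on the cosets `H g`; inversion in `G` turns these into left
  -- cosets.
  let i : coindV H.subtype (trivial k H k) →ₗ[k] (G ⧸ H → k) :=
    { toFun f x := Quotient.liftOn x (fun g => f.1 g⁻¹) (by
        intro a b hab
        have h1 : a⁻¹ * b ∈ H := QuotientGroup.leftRel_apply.1 hab
        have h2 := f.2 ⟨_, h1⟩ b⁻¹
        simpa using h2)
      map_add' _ _ := by
        ext x
        induction x using Quotient.inductionOn
        rfl
      map_smul' _ _ := by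
        ext x
        induction x using Quotient.inductionOn
        rfl }
  let r : (G ⧸ H → k) →ₗ[k] coindV H.subtype (trivial k H k) :=
    { toFun F := ⟨fun g => F (QuotientGroup.mk g⁻¹), fun h g => by
        have : (QuotientGroup.mk ((h : G) * g)⁻¹ : G ⧸ H) = QuotientGroup.mk g⁻¹ :=
          QuotientGroup.eq.2 (by simp)
        simp only [Subgroup.coe_subtype, trivial_apply, this]⟩
      map_add' _ _ := rfl
      map_smul' _ _ := rfl }
  refine ⟨⟨i, fun g => ?_⟩, ⟨r, fun g => ?_⟩, ?_⟩
  · ext f x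
    induction x using Quotient.inductionOn with | h x =>
    change f.1 (x⁻¹ * g) = f.1 (g⁻¹ * x)⁻¹
    simp
  · ext F x
    change F (g⁻¹ • QuotientGroup.mk x⁻¹) = F (QuotientGroup.mk (x * g)⁻¹)
    rw [mul_inv_rev]
    rfl
  · ext f x
    change f.1 x⁻¹⁻¹ = f.1 x
    rw [inv_inv]

lemma indTrivial_isSummand_funRep [Finite G] (H : Subgroup G) :
    (indTrivial k H).IsSummand (funRep k G (G ⧸ H)) := by
  classical
  refine IsSummand.trans ?_ (coind_trivial_isSummand_funRep H)
  let e := Rep.indCoindIso (Rep.of (trivial k H k))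
  refine ⟨e.hom.hom, e.inv.hom, ?_⟩
  have := congrArg Rep.Hom.hom e.hom_inv_id
  exact this

end FunRep

/-! ### Relative traces and the Brauer construction -/

section Traces

variable {k G V : Type*} [CommRing k] [Group G] [Finite G] [AddCommGroup V] [Module k V]

/-- Replaces the chosen coset representatives by a function on the quotient; `S` is kept separate
from `R.subgroupOf Q` so that a stabilizer can be substituted for it. -/
lemma relTrace_eq_sum (ρ : Representation k G V) {R Q : Subgroup G} {S : Subgroup Q}
    (hS : R.subgroupOf Q = S) [Fintype (Q ⧸ S)] {v : V} {f : Q ⧸ S → V}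
    (hf : ∀ q : Q, f (QuotientGroup.mk q) = ρ (q : G) v) :
    ρ.relTrace R Q v = ∑ z, f z := by
  subst hS
  rw [relTrace_apply, finsum_eq_sum_of_fintype]
  exact Finset.sum_congr rfl fun z _ => by rw [← hf, QuotientGroup.out_eq']

/-- The sum of a `Q`-equivariant family of vectors indexed by a `Q`-set without fixed points is a
sum of relative traces from proper subgroups. -/
lemma sum_mem_properTraces (ρ : Representation k G V) (Q : Subgroup G) {X : Type*} [Fintype X]
    [MulAction Q X] {F : X → V} (hF : ∀ (q : Q) (x : X), F (q • x) = ρ (q : G) (F x))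
    (hX : ∀ x : X, MulAction.stabilizer Q x ≠ ⊤) :
    ∑ x, F x ∈ ρ.properTraces Q := by
  classical
  let e := MulAction.selfEquivSigmaOrbitsQuotientStabilizer Q X
  let _ : ∀ x : X, Fintype (Q ⧸ MulAction.stabilizer Q x) := fun _ => Fintype.ofFinite _
  let _ : Fintype (MulAction.orbitRel.Quotient Q X) := Fintype.ofFinite _
  -- Split the sum over the orbits: each orbit contributes the relative trace of `F x` from the
  -- stabilizer of a representative `x`.
  rw [← e.symm.sum_comp, Fintype.sum_sigma]
  refine Submodule.sum_mem _ fun ω _ => ?_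
  set x : X := ω.out
  let R : Subgroup G := (MulAction.stabilizer Q x).map Q.subtype
  have hR : R.subgroupOf Q = MulAction.stabilizer Q x :=
    Subgroup.comap_map_eq_self_of_injective Q.subtype_injective _
  have hlt : R < Q := by
    refine lt_of_le_of_ne (Subgroup.map_subtype_le _) fun h => hX x ?_
    rw [← hR, h, Subgroup.subgroupOf_self]
  refine Submodule.mem_iSup_of_mem R (Submodule.mem_iSup_of_mem hlt ⟨F x, ?_, ?_⟩)
  · rw [SetLike.mem_coe, mem_fixedBy]
    rintro _ ⟨q, hq, rfl⟩
    exact (hF q x).symm.trans (congrArg F hq)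
  · refine relTrace_eq_sum ρ hR fun q => ?_
    rw [← hF]
    rfl

/-- If `Q` has no fixed point on `X`, the Brauer construction at `Q` of a summand of the
permutation module on `X` vanishes. -/
lemma IsSummand.subsingleton_brauerQuotient {ρ : Representation k G V} {X : Type*} [Finite X]
    [MulAction G X] (h : ρ.IsSummand (funRep k G X)) {Q : Subgroup G}
    (hX : ∀ x : X, ∃ q ∈ Q, q • x ≠ x) : Subsingleton (ρ.BrauerQuotient Q) := by
  classical
  obtain ⟨i, r, hir⟩ := h
  have hri (v : V) : r (i v) = v := congrArg (fun f => f v) hir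
  let _ := Fintype.ofFinite X
  rw [Submodule.Quotient.subsingleton_iff, Submodule.comap_subtype_eq_top]
  intro v hv
  have hsum : v = ∑ x : X, i v x • r (Pi.single x 1) := by
    conv_lhs => rw [← hri v, pi_eq_sum_univ' (i v), map_sum]
    refine Finset.sum_congr rfl fun x _ => ?_
    rw [map_smul]
  rw [hsum]
  refine sum_mem_properTraces ρ Q (fun q x => ?_) fun x hx => ?_
  -- Since `v` is fixed by `Q`, the coefficient function `i v` is constant on `Q`-orbits.
  · have h1 : i v (q • x) = i v x := by
      have h2 := congrFun (IntertwiningMap.isIntertwining _ _ i (q : G) v) (q • x)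
      rw [mem_fixedBy.1 hv _ q.2, funRep_apply] at h2
      rw [h2]
      exact congrArg (i v) (inv_smul_smul q x)
    rw [h1, map_smul, ← r.isIntertwining, funRep_single]
    rfl
  · obtain ⟨q, hq, hqx⟩ := hX x
    have : (⟨q, hq⟩ : Q) ∈ MulAction.stabilizer Q x := hx ▸ Subgroup.mem_top _
    exact hqx this

omit [Finite G] in
lemma fixedBy_eq_top_of_le_ker {ρ : Representation k G V} {Q : Subgroup G}
    (hQ : Q ≤ MonoidHom.ker ρ) : ρ.fixedBy Q = ⊤ := by
  refine eq_top_iff.2 fun v _ => mem_fixedBy.2 fun g hg => ?_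
  rw [MonoidHom.mem_ker.1 (hQ hg), Module.End.one_apply]

/-- Under a trivial action the trace from `R` is multiplication by the index of `R` in `Q`, a
nontrivial power of `p` when `R < Q`. -/
lemma properTraces_eq_bot_of_le_ker {p : ℕ} [Fact p.Prime] [CharP k p]
    {ρ : Representation k G V} {Q : Subgroup G} (hp : IsPGroup p Q)
    (hQ : Q ≤ MonoidHom.ker ρ) : ρ.properTraces Q = ⊥ := by
  refine eq_bot_iff.2 (iSup₂_le fun R hR => ?_)
  rintro _ ⟨v, -, rfl⟩
  let _ := Fintype.ofFinite (Q ⧸ R.subgroupOf Q)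
  rw [relTrace_eq_sum ρ rfl (f := fun _ => v) fun q => by
    rw [MonoidHom.mem_ker.1 (hQ q.2), Module.End.one_apply]]
  obtain ⟨n, hn⟩ := hp.index (R.subgroupOf Q)
  have hn0 : n ≠ 0 := by
    rintro rfl
    rw [pow_zero, Subgroup.index_eq_one, Subgroup.subgroupOf_eq_top] at hn
    exact hR.not_ge hn
  rw [Finset.sum_const, Finset.card_univ, ← Nat.card_eq_fintype_card, ← Subgroup.index, hn,
    ← Nat.cast_smul_eq_nsmul k, Nat.cast_pow, CharP.cast_eq_zero, zero_pow hn0, zero_smul]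
  exact Submodule.zero_mem _

/-- If `Q` acts trivially, the Brauer construction at `Q` does not change the module. -/
noncomputable def brauerQuotientEquivOfLeKer {p : ℕ} [Fact p.Prime] [CharP k p]
    (ρ : Representation k G V) {Q : Subgroup G} (hp : IsPGroup p Q)
    (hQ : Q ≤ MonoidHom.ker ρ) : V ≃ₗ[k] ρ.BrauerQuotient Q :=
  (LinearEquiv.ofTop _ (fixedBy_eq_top_of_le_ker hQ)).symm ≪≫ₗ
    (Submodule.quotEquivOfEqBot _ (by
      rw [properTraces_eq_bot_of_le_ker hp hQ, Submodule.comap_bot,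
        Submodule.ker_subtype])).symm

end Traces

/-! ### Transfer of indecomposability, and fixed vectors of `p`-groups -/

section Indecomposable

variable {k G V W : Type*} [CommRing k] [Group G] [AddCommGroup V] [Module k V]
  [AddCommGroup W] [Module k W]

/-- Indecomposability only depends on the submodules stable under the action. -/
lemma isIndecomposable_iff {ρ : Representation k G V} :
    ρ.IsIndecomposable ↔ Nontrivial V ∧ ∀ A B : Submodule k V, (∀ g, ∀ v ∈ A, ρ g v ∈ A) →
      (∀ g, ∀ v ∈ B, ρ g v ∈ B) → IsCompl A B → A = ⊥ ∨ B = ⊥ := by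
  refine and_congr_right fun _ => ⟨fun h A B hA hB hAB => ?_, fun h A B hAB => ?_⟩
  · refine (h ⟨A, hA⟩ ⟨B, hB⟩ ⟨disjoint_iff.2 ?_, codisjoint_iff.2 ?_⟩).imp
      (congrArg Subrepresentation.toSubmodule) (congrArg Subrepresentation.toSubmodule)
    · exact Subrepresentation.toSubmodule_injective hAB.inf_eq_bot
    · exact Subrepresentation.toSubmodule_injective hAB.sup_eq_top
  · exact (h _ _ A.apply_mem_toSubmodule B.apply_mem_toSubmodule (isCompl_toSubmodule hAB)).imp
      (fun h => Subrepresentation.toSubmodule_injective h)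
      (fun h => Subrepresentation.toSubmodule_injective h)

/-- Only the operators matter: if each `ρ g` is realized by some `σ h`, then `σ`-stable submodules
pull back to `ρ`-stable ones. The choice of `h` need not be a homomorphism, which permits passing
from a group to a subgroup with the same image. -/
lemma IsIndecomposable.of_equiv {H : Type*} [Group H] {ρ : Representation k G V}
    {σ : Representation k H W} (e : V ≃ₗ[k] W)
    (he : ∀ g, ∃ h, ∀ v, e (ρ g v) = σ h (e v)) (hρ : ρ.IsIndecomposable) :
    σ.IsIndecomposable := by
  rw [isIndecomposable_iff] at hρ ⊢
  have := hρ.1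
  refine ⟨e.injective.nontrivial, ?_⟩
  intro A B hA hB hAB
  have key (C : Submodule k W) (hC : ∀ h, ∀ w ∈ C, σ h w ∈ C) (g : G) (v : V)
      (hv : v ∈ C.comap e.toLinearMap) : ρ g v ∈ C.comap e.toLinearMap := by
    obtain ⟨h, hh⟩ := he g
    have h1 := hC h _ hv
    rw [Submodule.mem_comap]
    exact (hh v).symm ▸ h1
  have hbot (C : Submodule k W) (hC : C.comap e.toLinearMap = ⊥) : C = ⊥ := by
    rw [Submodule.eq_bot_iff] at hC ⊢
    intro w hw
    have := hC (e.symm w) (by simpa using hw)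
    simpa using this
  exact (hρ.2 _ _ (key A hA) (key B hB)
    ((Submodule.orderIsoMapComap e).symm.isCompl hAB)).imp (hbot A) (hbot B)

/-- A nonzero summand of an indecomposable module is everything. -/
lemma IsSummand.bijective_of_isIndecomposable [Nontrivial W] {ρ : Representation k G V}
    (hρ : ρ.IsIndecomposable) {σ : Representation k G W} {i : IntertwiningMap σ ρ}
    {r : IntertwiningMap ρ σ} (h : r.comp i = IntertwiningMap.id σ) : Function.Bijective i := by
  have hri (w : W) : r (i w) = w := congrArg (fun f => f w) h
  have hinj : Function.Injective i := Function.LeftInverse.injective hri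
  refine ⟨hinj, ?_⟩
  have hc : IsCompl (LinearMap.range i.toLinearMap) (LinearMap.ker r.toLinearMap) := by
    refine ⟨Submodule.disjoint_def.2 ?_, Submodule.codisjoint_iff_exists_add_eq.2 fun v => ?_⟩
    · rintro _ ⟨w, rfl⟩ hw
      have h0 : r (i w) = 0 := hw
      rw [← hri w, h0, map_zero]
    · refine ⟨i (r v), v - i (r v), ⟨r v, rfl⟩, ?_, add_sub_cancel _ _⟩
      rw [LinearMap.mem_ker, IntertwiningMap.toLinearMap_apply, map_sub, hri, sub_self]
  rcases (isIndecomposable_iff.1 hρ).2 _ _ i.range.apply_mem_toSubmodule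
    r.ker.apply_mem_toSubmodule hc with h0 | h0
  · obtain ⟨w, hw⟩ := exists_ne (0 : W)
    refine absurd (hinj ?_) hw
    rw [map_zero]
    exact (Submodule.eq_bot_iff _).1 h0 _ ⟨w, rfl⟩
  · intro v
    have h1 := hc.sup_eq_top
    change LinearMap.ker r.toLinearMap = ⊥ at h0
    rw [h0, sup_bot_eq] at h1
    exact LinearMap.range_eq_top.1 h1 v

lemma isIndecomposable_brauer_iff [Finite G] {p : ℕ} [Fact p.Prime] [CharP k p]
    {ρ : Representation k G V} {Q : Subgroup G} (hp : IsPGroup p Q) (hQ : Q ≤ MonoidHom.ker ρ) :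
    IsIndecomposable ((ρ.brauer Q).comp (Subgroup.inclusion (sup_centralizer_le_normalizer Q))) ↔
      IsIndecomposable (ρ.comp (Q ⊔ Subgroup.centralizer (Q : Set G)).subtype) := by
  have he (g : (Q ⊔ Subgroup.centralizer (Q : Set G) : Subgroup G)) (v : V) :
      brauerQuotientEquivOfLeKer ρ hp hQ (ρ.comp (Subgroup.subtype _) g v) =
        (ρ.brauer Q).comp (Subgroup.inclusion (sup_centralizer_le_normalizer Q)) g
          (brauerQuotientEquivOfLeKer ρ hp hQ v) := rfl
  refine ⟨fun h => h.of_equiv (brauerQuotientEquivOfLeKer ρ hp hQ).symm fun g => ⟨g, fun v => ?_⟩,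
    fun h => h.of_equiv (brauerQuotientEquivOfLeKer ρ hp hQ) fun g => ⟨g, he g⟩⟩
  rw [LinearEquiv.symm_apply_eq, he, LinearEquiv.apply_symm_apply]

/-- A `p`-group acting on a nonzero module in characteristic `p` fixes a nonzero vector. -/
lemma exists_fixed_of_isPGroup {p : ℕ} [Fact p.Prime] [CharP k p] [Finite G] (hG : IsPGroup p G)
    (ρ : Representation k G V) {A : Submodule k V} (hA : ∀ g, ∀ v ∈ A, ρ g v ∈ A) (h0 : A ≠ ⊥) :
    ∃ v ∈ A, v ≠ 0 ∧ ∀ g, ρ g v = v := by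
  obtain ⟨v, hv, hv0⟩ := A.exists_mem_ne_zero_of_ne_bot h0
  have hp (x : V) : p • x = 0 := by
    rw [← Nat.cast_smul_eq_nsmul k, CharP.cast_eq_zero, zero_smul]
  obtain ⟨_⟩ : Nonempty (Module (ZMod p) V) := ⟨AddCommGroup.zmodModule hp⟩
  -- The span is taken over the prime field so that it is a finite set, on which fixed points can be
  -- counted modulo `p`.
  let M : Submodule (ZMod p) V := Submodule.span (ZMod p) (Set.range fun g : G => ρ g v)
  have hMA (x : V) (hx : x ∈ M) : x ∈ A := by
    induction hx using Submodule.span_induction with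
    | mem x hx =>
      obtain ⟨g, rfl⟩ := hx
      exact hA g v hv
    | zero => exact A.zero_mem
    | add x y _ _ hx hy => exact A.add_mem hx hy
    | smul c x _ hx => exact ZMod.smul_mem hx c
  have hMs (g : G) (x : V) (hx : x ∈ M) : ρ g x ∈ M := by
    induction hx using Submodule.span_induction with
    | mem x hx =>
      obtain ⟨h, rfl⟩ := hx
      refine Submodule.subset_span ⟨g * h, ?_⟩
      simp
    | zero => simp
    | add x y _ _ hx hy => rw [map_add]; exact M.add_mem hx hy
    | smul c x _ hx =>
      rw [ZMod.map_smul]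
      exact M.smul_mem c hx
  have : Module.Finite (ZMod p) M := Module.Finite.span_of_finite _ (Set.finite_range _)
  have : Finite M := Module.finite_of_finite (ZMod p)
  let _ : MulAction G M :=
    { smul := fun g x => ⟨ρ g x, hMs g x x.2⟩
      one_smul := fun x => Subtype.ext (by change ρ 1 (x : V) = x; simp)
      mul_smul := fun g h x => Subtype.ext (by
        change ρ (g * h) (x : V) = ρ g (ρ h x); simp) }
  have hdvd : p ∣ Nat.card M := by
    have hvM : v ∈ M := Submodule.subset_span ⟨1, by simp⟩
    have hord : addOrderOf (⟨v, hvM⟩ : M) = p :=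
      addOrderOf_eq_prime (Subtype.ext (hp v)) fun h => hv0 (congrArg Subtype.val h)
    exact hord.symm.dvd.trans (addOrderOf_dvd_natCard _)
  -- The number of fixed points in `M` is divisible by `p`, so `0` is not the only one.
  obtain ⟨x, hx, hx0⟩ := hG.exists_fixed_point_of_prime_dvd_card_of_fixed_point M hdvd
    (a := (0 : M)) fun g => Subtype.ext (map_zero (ρ g))
  exact ⟨x, hMA x x.2, fun h => hx0 (Subtype.ext h).symm, fun g => congrArg Subtype.val (hx g)⟩

end Indecomposable

/-! ### Transitivity and indecomposability of permutation modules -/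

section PermutationModule

variable {k G : Type*} [Field k] [Group G] {X : Type*} [MulAction G X]

/-- A transitive permutation module of a `p`-group in characteristic `p` is indecomposable. -/
lemma isIndecomposable_funRep {p : ℕ} [Fact p.Prime] [CharP k p] [Finite G] (hG : IsPGroup p G)
    [Nonempty X] [MulAction.IsPretransitive G X] : (funRep k G X).IsIndecomposable := by
  refine isIndecomposable_iff.2 ⟨inferInstance, fun A B hA hB hAB => ?_⟩
  by_contra! h
  -- Invariant functions on a transitive set are constant, so every nonzero stable submodule
  -- contains the constant function `1`; two such submodules cannot be disjoint.
  have hconst (C : Submodule k (X → k)) (hC : ∀ g, ∀ v ∈ C, funRep k G X g v ∈ C) (h0 : C ≠ ⊥) :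
      (fun _ => 1 : X → k) ∈ C := by
    obtain ⟨f, hf, hf0, hfix⟩ := exists_fixed_of_isPGroup hG _ hC h0
    obtain ⟨x, hx⟩ := Function.ne_iff.1 hf0
    have : (fun _ => 1 : X → k) = (f x)⁻¹ • f := by
      ext y
      obtain ⟨g, rfl⟩ := MulAction.exists_smul_eq G x y
      have h1 := congrFun (hfix g) (g • x)
      rw [funRep_apply, inv_smul_smul] at h1
      rw [Pi.smul_apply, ← h1, smul_eq_mul, inv_mul_cancel₀ hx]
    rw [this]
    exact C.smul_mem _ hf
  have h1 := Submodule.disjoint_def.1 hAB.disjoint _ (hconst A hA h.1) (hconst B hB h.2)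
  obtain ⟨x⟩ := ‹Nonempty X›
  exact one_ne_zero (congrFun h1 x)

/-- If the restriction of a permutation module to a subgroup is indecomposable, the subgroup acts
transitively. -/
lemma exists_smul_eq_of_isIndecomposable_funRep {H : Subgroup G}
    (h : IsIndecomposable ((funRep k G X).comp H.subtype)) (x y : X) : ∃ g ∈ H, g • x = y := by
  classical
  let A (O : Set X) : Submodule k (X → k) :=
    { carrier := {f | ∀ x ∉ O, f x = 0}
      add_mem' := fun hf hg x hx => by rw [Pi.add_apply, hf x hx, hg x hx, add_zero]
      zero_mem' := fun _ _ => rfl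
      smul_mem' := fun c f hf x hx => by rw [Pi.smul_apply, hf x hx, smul_zero] }
  have hA (O : Set X) (hO : ∀ g ∈ H, ∀ x ∈ O, g • x ∈ O) (g : H) (f : X → k) (hf : f ∈ A O) :
      (funRep k G X).comp H.subtype g f ∈ A O := fun x hx =>
    hf _ fun hx' => hx (by simpa using hO g g.2 _ hx')
  have hne (O : Set X) (x : X) (hx : x ∈ O) : A O ≠ ⊥ := fun h0 => by
    have h1 : (Pi.single x 1 : X → k) ∈ A O := fun y hy =>
      Pi.single_eq_of_ne (fun hyx : y = x => hy (hyx ▸ hx)) _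
    rw [h0, Submodule.mem_bot] at h1
    simpa using congrFun h1 x
  have hc (O : Set X) : IsCompl (A O) (A Oᶜ) := by
    refine ⟨Submodule.disjoint_def.2 fun f h1 h2 => ?_,
      Submodule.codisjoint_iff_exists_add_eq.2 fun f =>
        ⟨O.indicator f, Oᶜ.indicator f, fun x hx => Set.indicator_of_notMem hx f,
          fun x hx => Set.indicator_of_notMem hx f, Set.indicator_self_add_compl O f⟩⟩
    ext x
    by_cases hx : x ∈ O
    · exact h2 x fun h => h hx
    · exact h1 x hx
  by_contra! hy
  -- Functions supported on the `H`-orbit of `x` and on its complement split the module.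
  let O : Set X := {z | ∃ g ∈ H, g • x = z}
  have hO (g : G) (hg : g ∈ H) (z : X) : z ∈ O → g • z ∈ O := by
    rintro ⟨a, ha, rfl⟩
    exact ⟨g * a, H.mul_mem hg ha, mul_smul _ _ _⟩
  have hO' (g : G) (hg : g ∈ H) (z : X) (hz : z ∈ Oᶜ) : g • z ∈ Oᶜ := fun h1 =>
    hz (by simpa using hO g⁻¹ (H.inv_mem hg) _ h1)
  rcases (isIndecomposable_iff.1 h).2 _ _ (hA O hO) (hA Oᶜ hO') (hc O) with h0 | h0
  · exact hne O x ⟨1, H.one_mem, one_smul _ _⟩ h0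
  · exact hne Oᶜ y (fun ⟨g, hg, h1⟩ => hy g hg h1) h0

/-- If `P` is normal in the `p`-group `N` and `S(N, P)` is Brauer indecomposable, then
`N = C_N(Q) P` for every subgroup `Q` of `P`. -/
lemma IsScottModule.centralizer_sup_eq_top {p : ℕ} [Fact p.Prime] [CharP k p] [Finite G]
    (hG : IsPGroup p G) {P : Subgroup G} [P.Normal] {W : Type*} [AddCommGroup W] [Module k W]
    {T : Representation k G W} (hT : T.IsScottModule P) (hTB : T.IsBrauerIndecomposable p)
    {Q : Subgroup G} (hQ : Q ≤ P) : Subgroup.centralizer (Q : Set G) ⊔ P = ⊤ := by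
  obtain ⟨hind, hsum, -⟩ := hT
  have := hind.1
  obtain ⟨i, r, hir⟩ := hsum.trans (indTrivial_isSummand_funRep P)
  have hbij := IsSummand.bijective_of_isIndecomposable (isIndecomposable_funRep hG) hir
  let e : W ≃ₗ[k] (G ⧸ P → k) := LinearEquiv.ofBijective i.toLinearMap hbij
  have he (g : G) (w : W) : e (T g w) = funRep k G (G ⧸ P) g (e w) :=
    IntertwiningMap.isIntertwining _ _ i g w
  -- The normal subgroup `P` acts trivially on `G ⧸ P`, hence so does `Q`.
  have hker : Q ≤ MonoidHom.ker T := by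
    intro g hg
    rw [MonoidHom.mem_ker]
    ext w
    refine e.injective (funext fun x => ?_)
    rw [he, funRep_apply, Module.End.one_apply]
    induction x using QuotientGroup.induction_on with | H x =>
    refine congrArg (e w) (QuotientGroup.eq.2 (?_ : (g⁻¹ * x)⁻¹ * x ∈ P))
    have := ‹P.Normal›.conj_mem g (hQ hg) x⁻¹
    simpa [mul_assoc] using this
  have hQp : IsPGroup p Q := hG.to_subgroup Q
  have h1 : IsIndecomposable (T.comp (Q ⊔ Subgroup.centralizer (Q : Set G)).subtype) := by
    refine (isIndecomposable_brauer_iff hQp hker).1 ((hTB Q hQp).resolve_left fun h => ?_)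
    exact not_subsingleton W (brauerQuotientEquivOfLeKer T hQp hker).toEquiv.subsingleton
  have h2 : IsIndecomposable
      ((funRep k G (G ⧸ P)).comp (Q ⊔ Subgroup.centralizer (Q : Set G)).subtype) :=
    h1.of_equiv e fun g => ⟨g, he g⟩
  refine eq_top_iff.2 fun g _ => ?_
  obtain ⟨h, hh, hg⟩ := exists_smul_eq_of_isIndecomposable_funRep h2
    (QuotientGroup.mk 1) (QuotientGroup.mk g)
  have h3 : h⁻¹ * g ∈ P := by
    rw [← QuotientGroup.eq, ← hg]
    exact congrArg QuotientGroup.mk (mul_one h).symm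
  have h4 : Q ⊔ Subgroup.centralizer (Q : Set G) ≤ Subgroup.centralizer (Q : Set G) ⊔ P :=
    sup_le (hQ.trans le_sup_right) le_sup_left
  rw [← mul_inv_cancel_left h g]
  exact mul_mem (h4 hh) (le_sup_right (a := Subgroup.centralizer (Q : Set G)) h3)

end PermutationModule

/-! ### The kernel of a summand and the Frattini argument -/

section KernelContainsVertex

variable {k G : Type*} [Field k] [Group G] [Finite G] {p : ℕ} [Fact p.Prime] [CharP k p]
  {V : Type*} [AddCommGroup V] [Module k V]

/-- If the `p`-subgroup `Q` acts trivially on a nonzero summand of `Ind_P^G(k)`, it is conjugate to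
a subgroup of `P`. -/
lemma IsSummand.exists_conj_mem_of_le_ker [Nontrivial V] {S : Representation k G V}
    {P : Subgroup G} (hS : S.IsSummand (indTrivial k P)) {Q : Subgroup G} (hQ : IsPGroup p Q)
    (hker : Q ≤ MonoidHom.ker S) : ∃ g : G, ∀ q ∈ Q, g⁻¹ * q * g ∈ P := by
  by_contra! h
  have := (hS.trans (indTrivial_isSummand_funRep P)).subsingleton_brauerQuotient (Q := Q)
    fun x => by
      induction x using QuotientGroup.induction_on with | H g =>
      obtain ⟨q, hq, hqg⟩ := h g
      refine ⟨q, hq, fun h1 => hqg ?_⟩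
      have h2 := QuotientGroup.eq.1 h1.symm
      simpa [mul_assoc] using h2
  exact not_subsingleton V (brauerQuotientEquivOfLeKer S hQ hker).toEquiv.subsingleton

/-- If a `p`-subgroup `P` acts trivially on a nonzero summand of `Ind_P^G(k)`, it is a Sylow
`p`-subgroup of the kernel, so that the Frattini argument applies. -/
lemma IsSummand.normalizer_sup_ker_eq_top [Nontrivial V] {S : Representation k G V}
    {P : Subgroup G} (hP : IsPGroup p P) (hS : S.IsSummand (indTrivial k P))
    (hker : P ≤ MonoidHom.ker S) :
    Subgroup.normalizer (P : Set G) ⊔ MonoidHom.ker S = ⊤ := by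
  obtain ⟨R, hR⟩ := (hP.comap_subtype (K := MonoidHom.ker S)).exists_le_sylow
  let R' : Subgroup G := (R : Subgroup (MonoidHom.ker S)).map (MonoidHom.ker S).subtype
  have hPR : P ≤ R' := by
    intro x hx
    exact ⟨⟨x, hker hx⟩, hR hx, rfl⟩
  -- A Sylow subgroup of the kernel containing `P` is also conjugate into `P`, so it equals `P` by
  -- order.
  obtain ⟨g, hg⟩ := hS.exists_conj_mem_of_le_ker (Q := R') (R.isPGroup'.map _)
    (Subgroup.map_subtype_le _)
  have hcard : Nat.card R' ≤ Nat.card P := by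
    refine Nat.card_le_card_of_injective (fun q : R' => (⟨g⁻¹ * q * g, hg q q.2⟩ : P)) ?_
    intro a b hab
    simpa using congrArg Subtype.val hab
  have hPR' : P = R' := Subgroup.eq_of_le_of_card_ge hPR hcard
  rw [hPR']
  exact R.normalizer_sup_eq_top

end KernelContainsVertex
end Representation

/-! ### The main theorem -/

theorem theorem4 (p : ℕ) [Fact p.Prime] {k : Type*} [Field k] [IsAlgClosed k] [CharP k p]
    {G : Type*} [Group G] [Finite G] (P : Subgroup G) (hP : IsPGroup p P)
    {V : Type*} [AddCommGroup V] [Module k V] (S : Representation k G V)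
    (hS : S.IsScottModule P)
    {W : Type*} [AddCommGroup W] [Module k W]
    (T : Representation k (Subgroup.normalizer (P : Set G)) W)
    (hT : T.IsScottModule (P.subgroupOf (Subgroup.normalizer (P : Set G))))
    (hker : P ≤ MonoidHom.ker S)
    (hN : IsPGroup p (Subgroup.normalizer (P : Set G)))
    (hTB : T.IsBrauerIndecomposable p) :
    S.IsBrauerIndecomposable p := by
  obtain ⟨hind, hsum, -⟩ := hS
  have := hind.1
  intro Q hQ
  by_cases hQK : Q ≤ MonoidHom.ker S
  · right
    rw [Representation.isIndecomposable_brauer_iff hQ hQK]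
    obtain ⟨x, hx⟩ := hsum.exists_conj_mem_of_le_ker hQ hQK
    -- `Q' = x⁻¹ Q x ≤ P`, as a subgroup of `N_G(P)`
    let Q' : Subgroup (Subgroup.normalizer (P : Set G)) :=
      (Q.map (MulAut.conj x⁻¹).toMonoidHom).subgroupOf _
    have hQ'P : Q' ≤ P.subgroupOf (Subgroup.normalizer (P : Set G)) := by
      rintro y ⟨q, hq, hqy⟩
      have h1 := hx q hq
      have h2 : x⁻¹ * q * x = (y : G) := by simpa using hqy
      rwa [h2] at h1
    have hC : Subgroup.centralizer (Q' : Set (Subgroup.normalizer (P : Set G))) ⊔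
        P.subgroupOf (Subgroup.normalizer (P : Set G)) = ⊤ :=
      hT.centralizer_sup_eq_top hN hTB hQ'P
    -- `D` is the conjugate `x⁻¹ (C_G(Q) K) x` with `K` the kernel of `S`; it is all of `G` once it
    -- contains both `K` and `N_G(P)`.
    let D : Subgroup G := (Subgroup.centralizer (Q : Set G) ⊔ MonoidHom.ker S).comap
      (MulAut.conj x).toMonoidHom
    have hKD : MonoidHom.ker S ≤ D := fun y hy => le_sup_right
      (a := Subgroup.centralizer (Q : Set G)) ((MonoidHom.normal_ker S).conj_mem y hy x)
    have hND : Subgroup.normalizer (P : Set G) ≤ D := by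
      have h1 : (⊤ : Subgroup (Subgroup.normalizer (P : Set G))) ≤ D.subgroupOf _ := by
        rw [← hC]
        -- An element `c` centralizing `x⁻¹ Q x` has `x c x⁻¹` centralizing `Q`.
        refine sup_le (fun c hc => ?_) fun c hc => hKD (hker hc)
        refine le_sup_left (b := MonoidHom.ker S) ?_
        refine Subgroup.mem_centralizer_iff.2 fun q hq => ?_
        have hqN : x⁻¹ * q * x ∈ Subgroup.normalizer (P : Set G) :=
          Subgroup.le_normalizer (hx q hq)
        have h2 := Subgroup.mem_centralizer_iff.1 hc ⟨_, hqN⟩ ⟨q, hq, by simp⟩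
        have h3 : x⁻¹ * q * x * (c : G) = c * (x⁻¹ * q * x) := congrArg Subtype.val h2
        change q * (x * (c : G) * x⁻¹) = x * c * x⁻¹ * q
        calc q * (x * (c : G) * x⁻¹) = x * (x⁻¹ * q * x * c) * x⁻¹ := by group
          _ = x * c * x⁻¹ * q := by rw [h3]; group
      exact fun y hy => h1 (Subgroup.mem_top ⟨y, hy⟩)
    have hD : D = ⊤ := eq_top_iff.2 <|
      (hsum.normalizer_sup_ker_eq_top hP hker).ge.trans (sup_le hND hKD)
    -- Writing `g = c y` with `c` in `C_G(Q)` and `y` in the kernel, `g` acts on `S` as `c` does.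
    refine hind.of_equiv (LinearEquiv.refl k V) fun g => ?_
    have hg : x⁻¹ * g * x ∈ D := hD ▸ Subgroup.mem_top _
    have hg' : g ∈ Subgroup.centralizer (Q : Set G) ⊔ MonoidHom.ker S := by
      have h1 : x * (x⁻¹ * g * x) * x⁻¹ ∈ Subgroup.centralizer (Q : Set G) ⊔ MonoidHom.ker S := hg
      have h2 : x * (x⁻¹ * g * x) * x⁻¹ = g := by group
      rwa [h2] at h1
    obtain ⟨c, hc, y, hy, rfl⟩ := Subgroup.mem_sup_of_normal_right.1 hg'
    refine ⟨⟨c, le_sup_right (a := Q) hc⟩, fun v => ?_⟩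
    change S (c * y) v = S c v
    rw [map_mul, MonoidHom.mem_ker.1 hy, mul_one]
  · left
    refine (hsum.trans
      (Representation.indTrivial_isSummand_funRep P)).subsingleton_brauerQuotient fun x => ?_
    -- A fixed coset `g P` would give `Q ≤ g P g⁻¹`, which lies in the normal subgroup
    -- `MonoidHom.ker S`.
    by_contra! hfix
    refine hQK fun q hq => ?_
    induction x using QuotientGroup.induction_on with | H g =>
    have h1 : g⁻¹ * q * g ∈ P := by
      have h2 := QuotientGroup.eq.1 (hfix q hq).symm
      simpa [mul_assoc] using h2
    have h3 := (MonoidHom.normal_ker S).conj_mem _ (hker h1) g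
    have h4 : g * (g⁻¹ * q * g) * g⁻¹ = q := by group
    rwa [h4] at h3
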